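/- Let $n\ge 2$, let $\Omega\subset\mathbb{R}^n$ be an open convex set, and let $v:\operatorname{cl}\Omega\to[0,\infty)$ be a convex function such that the set $S=\{x\in\Omega : v(x)=0\}$ is non-empty and compact and $v$ is locally strictly convex on $\Omega\setminus S$ (that is, every point of $\Omega\setminus S$ is the centre of a ball contained in $\Omega\setminus S$ on which $v$ is strictly convex). For $x\in\Omega$ let $$\partial v(x)=\{z\in\mathbb{R}^n : v(y)\ge v(x)+\langle z,y-x\rangle \text{ for every } y\in\Omega\},$$ and let $\mu_v(\omega)=\mathcal{H}^n\big(\bigcup_{x\in\omega}\partial v(x)\big)$, for Borel sets $\omega\subset\Omega$, be the Monge–Ampère measure of $v$, where $\mathcal{H}^n$ is $n$-dimensional Lebesgue measure. Let $\psi:(0,\infty)\to[0,\infty)$ be monotone decreasing (not necessarily strictly) and not identically zero, let $\tau_2>\tau_1>0$, and suppose that $\tau_1\psi(v)\le\det\nabla^2 v\le\tau_2\psi(v)$ in the sense of measure on $\Omega\setminus S$, i.e. $$\tau_1\int_\omega\psi(v(x))\,dx\le\mu_v(\omega)\le\tau_2\int_\omega\psi(v(x))\,dx\qquad\text{for every Borel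 set }\omega\subset\Omega\setminus S.$$ If the affine hull of $S$ has dimension at most $n-1$ and $\mu_v(S)=0$, then $S$ is a point. -/

import Mathlib

noncomputable section

namespace MongeAmpere

open MeasureTheory Set

/-- The subgradient `∂v(x)` of a function `v` on `Ω ⊆ ℝⁿ` at the point `x`. -/
def subgradient {n : ℕ} (Ω : Set (EuclideanSpace ℝ (Fin n)))
    (v : EuclideanSpace ℝ (Fin n) → ℝ) (x : EuclideanSpace ℝ (Fin n)) :
    Set (EuclideanSpace ℝ (Fin n)) :=
  {z | ∀ y ∈ Ω, v x + inner ℝ z (y - x) ≤ v y}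

/-- The image `N_v(ω) = ⋃_{x ∈ ω} ∂v(x)` of `ω` under the (multivalued) gradient map of `v`. -/
def gradientImage {n : ℕ} (Ω : Set (EuclideanSpace ℝ (Fin n)))
    (v : EuclideanSpace ℝ (Fin n) → ℝ) (ω : Set (EuclideanSpace ℝ (Fin n))) :
    Set (EuclideanSpace ℝ (Fin n)) :=
  ⋃ x ∈ ω, subgradient Ω v x

/-- The Monge–Ampère measure `μ_v(ω)` of a Borel set `ω ⊆ Ω`: the Lebesgue measure (that is, the
`n`-dimensional Hausdorff measure in its standard normalization) of `N_v(ω)`. -/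
def mongeAmpereMeasure {n : ℕ} (Ω : Set (EuclideanSpace ℝ (Fin n)))
    (v : EuclideanSpace ℝ (Fin n) → ℝ) (ω : Set (EuclideanSpace ℝ (Fin n))) : ENNReal :=
  volume (gradientImage Ω v ω)

/-- `τ₁ ψ(v) ≤ det ∇²v ≤ τ₂ ψ(v)` in the sense of measure on `A ⊆ Ω`. -/
def DetHessianBounds {n : ℕ} (Ω : Set (EuclideanSpace ℝ (Fin n)))
    (v : EuclideanSpace ℝ (Fin n) → ℝ) (ψ : ℝ → ℝ) (τ₁ τ₂ : ℝ)
    (A : Set (EuclideanSpace ℝ (Fin n))) : Prop :=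
  ∀ ω : Set (EuclideanSpace ℝ (Fin n)), MeasurableSet ω → ω ⊆ A →
    ENNReal.ofReal τ₁ * ∫⁻ x in ω, ENNReal.ofReal (ψ (v x)) ≤ mongeAmpereMeasure Ω v ω ∧
    mongeAmpereMeasure Ω v ω ≤ ENNReal.ofReal τ₂ * ∫⁻ x in ω, ENNReal.ofReal (ψ (v x))

/-- `v` is locally strictly convex on the open set `A`: every point of `A` is the centre of a ball
contained in `A` on which `v` is strictly convex. -/
def LocallyStrictConvexOn {n : ℕ} (A : Set (EuclideanSpace ℝ (Fin n)))
    (v : EuclideanSpace ℝ (Fin n) → ℝ) : Prop :=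
  ∀ x ∈ A, ∃ r : ℝ, 0 < r ∧ Metric.ball x r ⊆ A ∧ StrictConvexOn ℝ (Metric.ball x r) v

/-- The dimension of a (non-empty) set: the dimension of its affine hull. -/
def affineDim {n : ℕ} (S : Set (EuclideanSpace ℝ (Fin n))) : ℕ :=
  Module.finrank ℝ (affineSpan ℝ S).direction

end MongeAmpere

end

/-!
If `S` is not a point, two polar bodies of one section of `v` are compared, with a contradiction.

Pick `q ∈ S`, a vector `a` that is not constant on `S`, and a point `p ∈ S` maximizing `⟪a, ·⟫`
on `S` with `⟪a, p - q⟫ > 0`. For small `ε > 0` consider the section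
`Z = {x ∈ Ω | v x < ε ⟪a, x - q⟫}`, which is open, convex, relatively compact in `Ω`, and shrinks
towards `S` as `ε → 0` (`exists_section_subset_cthickening`). It contains `p` and
`z₀ = p - e`, where `e = (p - q) / 3`. Write `Z°_z = {u | ⟪u, x - z⟫ ≤ 1 for all x ∈ Z}`.

* Since `v` vanishes at `p`, sliding planes under the graph over `Z` shows that a translate of a
  multiple of `Z°_p` consists of subgradients on `Z` (`polarAt_subset_gradientImage`).
* Let `N` be the image of `Z` under the homothety with centre `z₀` and ratio `1 / 2`. All
  subgradients on `N` lie in a translate of a multiple of `Z°_{z₀}`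
  (`gradientImage_homothety_subset`).
* Since `v` vanishes at `z₀`, it does not increase along the homothety, so that `ψ ∘ v` does not
  decrease. As `S` is a null set, this makes the measure with density `ψ ∘ v`, and hence `μ_v`,
  doubling from `N` to `Z` (`setLIntegral_le_homothety`).

Together these give `|Z°_p| ≤ C |Z°_{z₀}|` with `C` depending only on `n` and `τ₂ / τ₁`
(`volume_polarAt_le_of_detHessianBounds`). On the other hand, as `ε → 0` the point `p` comes close
to a supporting hyperplane of `Z` orthogonal to `a`, while `z₀` does not. Then `Z°_p` contains long
vectors in the direction of `a`, and so arbitrarily many disjoint copies of `Z°_{z₀}`, each shrunk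
by a factor of at least `1 / 6` (`nat_mul_volume_polarAt_le`).
-/

namespace MongeAmpere

open MeasureTheory Set Module
open scoped Pointwise

/-! ### Polar bodies with respect to different base points -/

section Polar

variable {E : Type*} [NormedAddCommGroup E] [InnerProductSpace ℝ E]

/-- The polar of `Z` with respect to the base point `z`, that is, the polar of `Z - z` in the
one-sided sense. -/
def polarAt (Z : Set E) (z : E) : Set E :=
  {u | ∀ x ∈ Z, inner ℝ u (x - z) ≤ 1}

lemma isClosed_polarAt (Z : Set E) (z : E) : IsClosed (polarAt Z z) := by
  have : polarAt Z z = ⋂ x ∈ Z, {u : E | inner ℝ u (x - z) ≤ 1} := by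
    ext u; simp [polarAt]
  rw [this]
  exact isClosed_biInter fun x _ => isClosed_le (by fun_prop) continuous_const

lemma polarAt_subset_closedBall {Z : Set E} {z : E} {r : ℝ} (hr : 0 < r)
    (hZ : Metric.closedBall z r ⊆ Z) : polarAt Z z ⊆ Metric.closedBall 0 (1 / r) := by
  intro u hu
  rw [mem_closedBall_zero_iff]
  rcases eq_or_ne u 0 with rfl | h0
  · simp [hr.le]
  have hn : 0 < ‖u‖ := norm_pos_iff.mpr h0
  have hmem : z + (r / ‖u‖) • u ∈ Z := hZ <| by
    rw [mem_closedBall_iff_norm, add_sub_cancel_left, norm_smul, Real.norm_of_nonneg (by positivity),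
      div_mul_cancel₀ _ hn.ne']
  have h := hu _ hmem
  rw [add_sub_cancel_left, inner_smul_right, real_inner_self_eq_norm_sq] at h
  rw [le_div_iff₀ hr]
  calc ‖u‖ * r = r / ‖u‖ * ‖u‖ ^ 2 := by field_simp
    _ ≤ 1 := h

lemma ball_subset_polarAt {Z : Set E} {z : E} {R : ℝ} (hR : 0 < R)
    (hZ : Z ⊆ Metric.closedBall z R) : Metric.ball 0 (1 / R) ⊆ polarAt Z z := by
  intro u hu x hx
  have hx' := hZ hx
  rw [mem_ball_zero_iff, lt_div_iff₀ hR] at hu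
  rw [mem_closedBall_iff_norm] at hx'
  calc inner ℝ u (x - z) ≤ ‖u‖ * ‖x - z‖ := real_inner_le_norm _ _
    _ ≤ ‖u‖ * R := by gcongr
    _ ≤ 1 := hu.le

/-- As `p - e - e ∈ Z`, the functional `⟪u, ·⟫` is at most `2` on `Z - p` for `u` in the polar body
at `p - e`, so that the sum of `Y` and `u` is at most `3` there. -/
lemma smul_add_mem_polarAt {Z : Set E} {p e Y u : E} {s : ℝ} (he : p - e - e ∈ Z)
    (hY : ∀ x ∈ Z, inner ℝ Y (x - p) ≤ 1) (hu : u ∈ polarAt Z (p - e)) (hs : 0 ≤ s)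
    (hs' : s ≤ 1 / 3) : s • (Y + u) ∈ polarAt Z p := by
  intro x hx
  have h1 := hu x hx
  have h2 := hu _ he
  have h3 := hY x hx
  have h4 : inner ℝ u (x - p) ≤ 2 := by
    have : x - p = (x - (p - e)) + (p - e - e - (p - e)) := by abel
    rw [this, inner_add_right]; linarith
  rw [inner_smul_left, inner_add_left]
  simp only [conj_trivial]
  nlinarith

variable [FiniteDimensional ℝ E] [MeasurableSpace E] [BorelSpace E]

/-- The polar body at `p` contains the sets `s • (Y + L)`, where `L` is the polar body at
`p - e` and `1 / 6 ≤ s ≤ 1 / 3`. When `⟪Y, e⟫` is large, the functional `⟪·, e⟫` separates many of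
them from each other. -/
lemma nat_mul_volume_polarAt_le {Z : Set E} {p e Y : E} (m : ℕ) (hp : p ∈ Z)
    (he : p - e - e ∈ Z) (hY : ∀ x ∈ Z, inner ℝ Y (x - p) ≤ 1) (hYe : 4 * (m : ℝ) < inner ℝ Y e) :
    m * (ENNReal.ofReal ((1 / 6) ^ finrank ℝ E) * volume (polarAt Z (p - e))) ≤
      volume (polarAt Z p) := by
  set L := polarAt Z (p - e) with hL
  have hbound : ∀ u ∈ L, |inner ℝ u e| ≤ 1 := by
    intro u hu
    have h1 := hu p hp
    have h2 := hu _ he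
    rw [sub_sub_cancel] at h1
    rw [sub_sub_cancel_left, inner_neg_right] at h2
    exact abs_le.mpr ⟨by linarith, h1⟩
  -- The scaling factors are equally spaced in `[1 / 6, 1 / 3]`.
  let s : Fin m → ℝ := fun k => 1 / 6 + k / (6 * m)
  have hs6 : ∀ k, 1 / 6 ≤ s k := fun k => by
    have : (0 : ℝ) ≤ (k : ℝ) / (6 * m) := by positivity
    simp only [s]; linarith
  have hs3 : ∀ k, s k ≤ 1 / 3 := fun k => by
    have hm : (0 : ℝ) < m := by exact_mod_cast k.pos
    have hk : (k : ℝ) ≤ m := by exact_mod_cast k.2.le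
    have : (k : ℝ) / (6 * m) ≤ 1 / 6 := by
      rw [div_le_div_iff₀ (by positivity) (by norm_num)]; linarith
    simp only [s]; linarith
  have hdisj : ∀ i j : Fin m, i < j → Disjoint (s i • (Y +ᵥ L)) (s j • (Y +ᵥ L)) := by
    intro i j hij
    rw [Set.disjoint_left]
    rintro _ ⟨_, ⟨u, hu, rfl⟩, rfl⟩ ⟨_, ⟨u', hu', rfl⟩, h⟩
    have hm : (0 : ℝ) < m := by exact_mod_cast i.pos
    have hgap : s i + 1 / (6 * m) ≤ s j := by
      have : (i : ℝ) + 1 ≤ j := by exact_mod_cast hij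
      have h' : ((i : ℝ) + 1) / (6 * m) ≤ j / (6 * m) := by gcongr
      simp only [s]; rw [add_div] at h'; linarith
    have h' := congrArg (fun y => inner ℝ y e) h
    simp only [vadd_eq_add, inner_smul_left, inner_add_left, conj_trivial] at h'
    have b := abs_le.mp (hbound u hu)
    have b' := abs_le.mp (hbound u' hu')
    have g : 2 / 3 < (1 / (6 * (m : ℝ))) * inner ℝ Y e := by
      rw [div_mul_eq_mul_div, lt_div_iff₀ (by positivity)]; linarith
    have hF : (0 : ℝ) < inner ℝ Y e := by linarith
    have := hs6 i; have := hs6 j; have := hs3 i; have := hs3 j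
    have k1 := mul_le_mul_of_nonneg_right hgap hF.le
    have k2 : s i * inner ℝ u e ≤ s i := by nlinarith
    have k3 : -s j ≤ s j * inner ℝ u' e := by nlinarith
    nlinarith
  have hsub : (⋃ k, s k • (Y +ᵥ L)) ⊆ polarAt Z p := by
    refine iUnion_subset fun k => ?_
    rintro _ ⟨_, ⟨u, hu, rfl⟩, rfl⟩
    exact smul_add_mem_polarAt he hY hu (by linarith [hs6 k]) (hs3 k)
  have hpair : Pairwise (Function.onFun Disjoint fun k => s k • (Y +ᵥ L)) := by
    intro i j hij
    rcases lt_or_gt_of_ne hij with h | h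
    · exact hdisj i j h
    · exact (hdisj j i h).symm
  have hmeas : ∀ k, MeasurableSet (s k • (Y +ᵥ L)) := fun k =>
    (((isClosed_polarAt Z (p - e)).vadd Y).measurableSet).const_smul₀ (s k)
  calc (m : ENNReal) * (ENNReal.ofReal ((1 / 6) ^ finrank ℝ E) * volume L)
      = ∑ _k : Fin m, ENNReal.ofReal ((1 / 6) ^ finrank ℝ E) * volume L := by simp
    _ ≤ ∑ k : Fin m, volume (s k • (Y +ᵥ L)) := by
        refine Finset.sum_le_sum fun k _ => ?_
        rw [Measure.addHaar_smul, measure_vadd, abs_of_nonneg (pow_nonneg (by linarith [hs6 k]) _)]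
        gcongr
        exact hs6 k
    _ = volume (⋃ k, s k • (Y +ᵥ L)) := by
        rw [measure_iUnion hpair hmeas, tsum_fintype]
    _ ≤ volume (polarAt Z p) := measure_mono hsub

end Polar

/-! ### Sections and their gradient images -/

section Section

variable {n : ℕ} {Ω : Set (EuclideanSpace ℝ (Fin n))} {v : EuclideanSpace ℝ (Fin n) → ℝ}

/-- Lower bound for the gradient image of a section, as in Aleksandrov's maximum principle: the
section `Z` is cut off by the affine function `⟪b, ·⟫ - c`, which exceeds `v` by `2 * h` at `p`.
For `y` in the polar body at `p`, the function `v - ⟪b + h • y, ·⟫` attains its minimum over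
`closure Z` inside `Z`, and the minimizer has `b + h • y` as a subgradient. -/
lemma polarAt_subset_gradientImage (hΩ : IsOpen Ω) (hv : ConvexOn ℝ Ω v)
    {b p : EuclideanSpace ℝ (Fin n)}
    {c : ℝ} {Z : Set (EuclideanSpace ℝ (Fin n))} (hZ : Z = {x | x ∈ Ω ∧ v x < inner ℝ b x - c})
    (hZb : Bornology.IsBounded Z) (hZΩ : closure Z ⊆ Ω) {h : ℝ} (hp : p ∈ Z)
    (hh : v p = inner ℝ b p - c - 2 * h) :
    b +ᵥ h • polarAt Z p ⊆ gradientImage Ω v Z := by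
  rintro _ ⟨_, ⟨y, hy, rfl⟩, rfl⟩
  simp only [vadd_eq_add]
  have hpos : 0 < h := by
    have := hp; rw [hZ] at this; linarith [this.2]
  have hcont : ContinuousOn v Ω := hv.continuousOn hΩ
  let f : EuclideanSpace ℝ (Fin n) → ℝ := fun x => v x - inner ℝ (b + h • y) x
  have hfcont : ContinuousOn f (closure Z) :=
    (hcont.mono hZΩ).sub (by fun_prop)
  obtain ⟨x, hx, hmin⟩ := (hZb.isCompact_closure).exists_isMinOn ⟨p, subset_closure hp⟩ hfcont
  have hpol : inner ℝ y (x - p) ≤ 1 := by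
    have hc : IsClosed {x : EuclideanSpace ℝ (Fin n) | inner ℝ y (x - p) ≤ 1} :=
      isClosed_le (by fun_prop) continuous_const
    exact closure_minimal (fun x hx => hy x hx) hc hx
  -- On the boundary of `Z` the function `f` exceeds its value at `p` by at least `h`.
  have hxZ : x ∈ Z := by
    by_contra hxZ
    have h1 : inner ℝ b x - c ≤ v x := by
      by_contra hlt
      exact hxZ (hZ ▸ ⟨hZΩ hx, not_le.mp hlt⟩)
    have h2 : f x ≤ f p := hmin (subset_closure hp)
    simp only [f, inner_add_left, inner_smul_left, conj_trivial] at h2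
    rw [inner_sub_right] at hpol
    nlinarith
  have hZo : IsOpen Z := by
    have : Z = Ω ∩ (fun x => v x - inner ℝ b x) ⁻¹' Iio (-c) := by
      rw [hZ]; ext x; simp only [mem_ofPred_eq, mem_inter_iff, mem_preimage, mem_Iio]
      constructor <;> rintro ⟨h1, h2⟩ <;> exact ⟨h1, by linarith⟩
    rw [this]
    exact (hcont.sub (by fun_prop)).isOpen_inter_preimage hΩ isOpen_Iio
  have hfconv : ConvexOn ℝ Ω f := hv.sub ((innerₛₗ ℝ (b + h • y)).concaveOn hv.1)
  have hloc : IsLocalMinOn f Ω x :=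
    ((hmin.on_subset subset_closure).isLocalMin (hZo.mem_nhds hxZ)).on Ω
  have hglob := IsMinOn.of_isLocalMinOn_of_convexOn (hZΩ hx) hloc hfconv
  refine mem_biUnion hxZ fun w hw => ?_
  have := hglob hw
  simp only [f, mem_ofPred_eq] at this
  rw [inner_sub_right]
  linarith

/-- Upper bound for the gradient image of half of a section, where `v` is at most `M` below the
affine function `⟪b, ·⟫ - c` that cuts off `Z`: around a point of the half-size copy of `Z`, a
translate of that copy still fits into `Z`. -/
lemma gradientImage_homothety_subset (hv0 : ∀ x ∈ Ω, 0 ≤ v x) {b z₀ : EuclideanSpace ℝ (Fin n)}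
    {c : ℝ} {Z : Set (EuclideanSpace ℝ (Fin n))} (hZ : Z = {x | x ∈ Ω ∧ v x < inner ℝ b x - c})
    (hZc : Convex ℝ Z) {M : ℝ} (hM : 0 < M) (hz₀ : z₀ ∈ Z) (hbound : ∀ x ∈ Z, inner ℝ b x - c ≤ M) :
    gradientImage Ω v (AffineMap.homothety z₀ (2⁻¹ : ℝ) '' Z) ⊆ b +ᵥ (2 * M) • polarAt Z z₀ := by
  intro z hz
  simp only [gradientImage, mem_iUnion] at hz
  obtain ⟨_, ⟨x, hx, rfl⟩, hz⟩ := hz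
  have hmid : ∀ x ∈ Z, ∀ y ∈ Z, (2⁻¹ : ℝ) • x + (2⁻¹ : ℝ) • y ∈ Z := fun x hx y hy =>
    hZc hx hy (by norm_num) (by norm_num) (by norm_num)
  have heq : AffineMap.homothety z₀ (2⁻¹ : ℝ) x = (2⁻¹ : ℝ) • x + (2⁻¹ : ℝ) • z₀ := by
    rw [AffineMap.homothety_apply, vsub_eq_sub, vadd_eq_add]; module
  rw [heq] at hz
  refine ⟨z - b, ?_, by simp⟩
  rw [mem_smul_set_iff_inv_smul_mem₀ (by positivity)]
  intro y hy
  have h1 := hmid x hx z₀ hz₀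
  have h2 := hmid x hx y hy
  have h3 := hbound _ h1
  rw [hZ] at h1 h2
  have h4 := hv0 _ h1.1
  have h5 := hz _ h2.1
  have h6 := h2.2
  have hd : (2⁻¹ : ℝ) • x + (2⁻¹ : ℝ) • y - ((2⁻¹ : ℝ) • x + (2⁻¹ : ℝ) • z₀) =
      (2⁻¹ : ℝ) • (y - z₀) := by module
  rw [hd] at h5
  rw [inner_smul_left, conj_trivial, inv_mul_le_iff₀ (by positivity)]
  simp only [inner_sub_left, inner_sub_right, inner_add_right, inner_smul_right] at *
  linarith

/-- The doubling property of `ψ ∘ v`: the homothety with centre `z₀ ∈ S` does not increase `v`.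
It may map points outside `S` into `S`, where `ψ` is not controlled; these form a null set because
`S` has measure zero. -/
lemma setLIntegral_le_homothety (hv : ConvexOn ℝ Ω v) (hv0 : ∀ x ∈ Ω, 0 ≤ v x)
    {S : Set (EuclideanSpace ℝ (Fin n))} (hS : S = {x | x ∈ Ω ∧ v x = 0}) (hS0 : volume S = 0)
    {ψ : ℝ → ℝ} (hψ : AntitoneOn ψ (Ioi 0)) {Z : Set (EuclideanSpace ℝ (Fin n))} (hZΩ : Z ⊆ Ω)
    (hZ : MeasurableSet Z) (hSm : MeasurableSet S) {z₀ : EuclideanSpace ℝ (Fin n)} (hz₀ : z₀ ∈ S) :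
    ∫⁻ x in Z \ S, ENNReal.ofReal (ψ (v x)) ≤
      2 ^ n * ∫⁻ x in (AffineMap.homothety z₀ (2⁻¹ : ℝ) '' Z) \ S, ENNReal.ofReal (ψ (v x)) := by
  set φ : EuclideanSpace ℝ (Fin n) → EuclideanSpace ℝ (Fin n) :=
    ⇑(AffineMap.homothety z₀ (2⁻¹ : ℝ)) with hφ
  have hφeq : ∀ x, φ x = (2⁻¹ : ℝ) • (x - z₀) + z₀ := fun x => by
    simp [hφ, AffineMap.homothety_apply]
  let Φ : EuclideanSpace ℝ (Fin n) ≃ₜ EuclideanSpace ℝ (Fin n) :=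
    ((Homeomorph.subRight z₀).trans (Homeomorph.smulOfNeZero (2⁻¹ : ℝ) (by norm_num))).trans
      (Homeomorph.addRight z₀)
  have hΦ : ⇑Φ = φ := by
    ext1 x; rw [hφeq]; rfl
  have hme : MeasurableEmbedding φ := hΦ ▸ Φ.measurableEmbedding
  -- The homothety with ratio `1/2` scales Lebesgue measure by `2⁻ⁿ`.
  have himg : ∀ A : Set (EuclideanSpace ℝ (Fin n)), volume (φ '' A) = (2 ^ n)⁻¹ * volume A := by
    intro A
    rw [hφ, Measure.addHaar_image_homothety]
    simp [abs_of_nonneg, ENNReal.ofReal_inv_of_pos]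
  have hpre : ∀ A : Set (EuclideanSpace ℝ (Fin n)), volume (φ ⁻¹' A) = 2 ^ n * volume A := by
    intro A
    have hsurj : Function.Surjective φ := hΦ ▸ Φ.surjective
    have := himg (φ ⁻¹' A)
    rw [image_preimage_eq _ hsurj] at this
    rw [this, ← mul_assoc, ENNReal.mul_inv_cancel (by positivity) (by finiteness), one_mul]
  have hmap : Measure.map φ volume = (2 ^ n : ENNReal) • volume := by
    ext A hA
    rw [Measure.map_apply hme.measurable hA, hpre]; simp
  have hnull : volume (φ ⁻¹' S) = 0 := by rw [hpre, hS0, mul_zero]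
  have hz₀' : z₀ ∈ Ω ∧ v z₀ = 0 := by rw [hS] at hz₀; exact hz₀
  -- Restrict to the points that are not mapped into `S`, compare pointwise, change variables.
  calc ∫⁻ x in Z \ S, ENNReal.ofReal (ψ (v x))
      = ∫⁻ x in (Z \ S) \ φ ⁻¹' S, ENNReal.ofReal (ψ (v x)) := by
        exact (setLIntegral_congr (sdiff_null_ae_eq_self hnull)).symm
    _ ≤ ∫⁻ x in (Z \ S) \ φ ⁻¹' S, ENNReal.ofReal (ψ (v (φ x))) := by
        refine setLIntegral_mono' ((hZ.diff hSm).diff (hme.measurable hSm)) fun x hx => ?_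
        have hxΩ : x ∈ Ω := hZΩ hx.1.1
        have hcomb : φ x = (2⁻¹ : ℝ) • x + (2⁻¹ : ℝ) • z₀ := by rw [hφeq]; module
        have hφΩ : φ x ∈ Ω := by
          rw [hcomb]
          exact hv.1 hxΩ hz₀'.1 (by norm_num) (by norm_num) (by norm_num)
        have hle : v (φ x) ≤ 2⁻¹ * v x := by
          rw [hcomb]
          have := hv.2 hxΩ hz₀'.1 (show (0 : ℝ) ≤ 2⁻¹ by norm_num)
            (show (0 : ℝ) ≤ 2⁻¹ by norm_num) (by norm_num)
          simpa [hz₀'.2] using this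
        have hpos : ∀ y ∈ Ω, y ∉ S → 0 < v y := fun y hy hyS =>
          lt_of_le_of_ne (hv0 y hy) fun h => hyS (hS ▸ ⟨hy, h.symm⟩)
        have hp1 := hpos _ hxΩ hx.1.2
        exact ENNReal.ofReal_le_ofReal (hψ (hpos _ hφΩ hx.2) hp1 (by linarith))
    _ ≤ ∫⁻ x in φ ⁻¹' ((φ '' Z) \ S), ENNReal.ofReal (ψ (v (φ x))) := by
        refine lintegral_mono_set fun x hx => ⟨mem_image_of_mem _ hx.1.1, hx.2⟩
    _ = 2 ^ n * ∫⁻ x in (φ '' Z) \ S, ENNReal.ofReal (ψ (v x)) := by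
        rw [← smul_eq_mul, ← lintegral_smul_measure, ← Measure.restrict_smul, ← hmap,
          hme.restrict_map, hme.lintegral_map]

/-- The bounds on the gradient images of `Z` and of its half-size copy, linked by doubling. The
height of the affine function above `v` is `2 * h` at `p`, and at most `4 * h` on `Z`. -/
lemma volume_polarAt_le_of_detHessianBounds (hΩ : IsOpen Ω) (hv : ConvexOn ℝ Ω v)
    (hv0 : ∀ x ∈ Ω, 0 ≤ v x)
    {S : Set (EuclideanSpace ℝ (Fin n))} (hS : S = {x | x ∈ Ω ∧ v x = 0})
    (hSm : MeasurableSet S) (hS0 : volume S = 0) (hS_null : mongeAmpereMeasure Ω v S = 0)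
    {ψ : ℝ → ℝ} (hψ : AntitoneOn ψ (Ioi 0)) {τ₁ τ₂ : ℝ} (hτ₁ : 0 < τ₁) (hτ₂ : 0 < τ₂)
    (hMA : DetHessianBounds Ω v ψ τ₁ τ₂ (Ω \ S))
    {b p z₀ : EuclideanSpace ℝ (Fin n)}
    {c : ℝ} {Z : Set (EuclideanSpace ℝ (Fin n))} (hZ : Z = {x | x ∈ Ω ∧ v x < inner ℝ b x - c})
    (hZo : IsOpen Z) (hZc : Convex ℝ Z)
    (hZb : Bornology.IsBounded Z) (hZΩ : closure Z ⊆ Ω) {h : ℝ} (hp : p ∈ Z) (hpS : p ∈ S)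
    (hz₀ : z₀ ∈ Z) (hz₀S : z₀ ∈ S)
    (hh : 2 * h = inner ℝ b p - c) (hbound : ∀ x ∈ Z, inner ℝ b x - c ≤ 4 * h) :
    volume (polarAt Z p) ≤ ENNReal.ofReal (16 ^ n * (τ₂ / τ₁)) * volume (polarAt Z z₀) := by
  have hpos : 0 < h := by
    have := hp; rw [hZ] at this; linarith [this.2, hv0 p this.1]
  have hZΩ' : Z ⊆ Ω := subset_closure.trans hZΩ
  have hvp : v p = 0 := by rw [hS] at hpS; exact hpS.2
  set N := AffineMap.homothety z₀ (2⁻¹ : ℝ) '' Z with hN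
  have hNZ : N ⊆ Z := by
    rintro _ ⟨x, hx, rfl⟩
    have : AffineMap.homothety z₀ (2⁻¹ : ℝ) x = (2⁻¹ : ℝ) • x + (2⁻¹ : ℝ) • z₀ := by
      rw [AffineMap.homothety_apply, vsub_eq_sub, vadd_eq_add]; module
    rw [this]
    exact hZc hx hz₀ (by norm_num) (by norm_num) (by norm_num)
  have hNm : MeasurableSet N :=
    ((AffineMap.homothety_isOpenMap z₀ (2⁻¹ : ℝ) (by norm_num)) Z hZo).measurableSet
  have h1 : ENNReal.ofReal (h ^ n) * volume (polarAt Z p) ≤ mongeAmpereMeasure Ω v Z := by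
    have := measure_mono (μ := volume)
      (polarAt_subset_gradientImage hΩ hv hZ hZb hZΩ hp (h := h) (by linarith))
    rwa [measure_vadd, Measure.addHaar_smul, finrank_euclideanSpace_fin,
      abs_of_nonneg (by positivity)] at this
  have h2 : mongeAmpereMeasure Ω v Z ≤ mongeAmpereMeasure Ω v (Z \ S) := by
    have hsub : gradientImage Ω v Z ⊆ gradientImage Ω v (Z \ S) ∪ gradientImage Ω v S := by
      unfold gradientImage
      rw [← biUnion_union, sdiff_union_self]
      exact biUnion_subset_biUnion_left subset_union_left
    calc mongeAmpereMeasure Ω v Z ≤ mongeAmpereMeasure Ω v (Z \ S) + mongeAmpereMeasure Ω v S :=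
          (measure_mono hsub).trans (measure_union_le _ _)
      _ = mongeAmpereMeasure Ω v (Z \ S) := by rw [hS_null, add_zero]
  have h3 := (hMA (Z \ S) (hZo.measurableSet.diff hSm) (sdiff_subset_sdiff_left hZΩ')).2
  have h4 := setLIntegral_le_homothety hv hv0 hS hS0 hψ hZΩ' hZo.measurableSet hSm hz₀S
  have h5 := (hMA (N \ S) (hNm.diff hSm) (sdiff_subset_sdiff_left (hNZ.trans hZΩ'))).1
  have h6 : mongeAmpereMeasure Ω v (N \ S) ≤
      ENNReal.ofReal ((8 * h) ^ n) * volume (polarAt Z z₀) := by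
    have hsub : gradientImage Ω v (N \ S) ⊆ gradientImage Ω v N :=
      biUnion_subset_biUnion_left sdiff_subset
    have := measure_mono (μ := volume) (hsub.trans
      (gradientImage_homothety_subset hv0 hZ hZc (M := 4 * h) (by positivity) hz₀ hbound))
    rw [measure_vadd, Measure.addHaar_smul, finrank_euclideanSpace_fin,
      abs_of_nonneg (by positivity)] at this
    rwa [show 8 * h = 2 * (4 * h) by ring]
  set I := ∫⁻ x in N \ S, ENNReal.ofReal (ψ (v x))
  have h7 : I ≤ ENNReal.ofReal τ₁⁻¹ * mongeAmpereMeasure Ω v (N \ S) := by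
    calc I = ENNReal.ofReal τ₁⁻¹ * (ENNReal.ofReal τ₁ * I) := by
          rw [← mul_assoc, ← ENNReal.ofReal_mul (by positivity), inv_mul_cancel₀ hτ₁.ne',
            ENNReal.ofReal_one, one_mul]
      _ ≤ _ := by gcongr
  have h8 : ENNReal.ofReal (h ^ n) * volume (polarAt Z p) ≤
      ENNReal.ofReal τ₂ * (ENNReal.ofReal (2 ^ n) * (ENNReal.ofReal τ₁⁻¹ *
        (ENNReal.ofReal ((8 * h) ^ n) * volume (polarAt Z z₀)))) := by
    have h2n : ENNReal.ofReal (2 ^ n) = 2 ^ n := by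
      rw [ENNReal.ofReal_pow (by norm_num), ENNReal.ofReal_ofNat]
    rw [h2n]
    calc _ ≤ _ := h1.trans (h2.trans h3)
      _ ≤ _ := by gcongr; exact h4.trans (by gcongr; exact h7.trans (by gcongr))
  calc volume (polarAt Z p)
      = ENNReal.ofReal (h ^ n)⁻¹ * (ENNReal.ofReal (h ^ n) * volume (polarAt Z p)) := by
        rw [← mul_assoc, ← ENNReal.ofReal_mul (by positivity), inv_mul_cancel₀ (by positivity),
          ENNReal.ofReal_one, one_mul]
    _ ≤ ENNReal.ofReal (h ^ n)⁻¹ * (ENNReal.ofReal τ₂ * (ENNReal.ofReal (2 ^ n) *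
          (ENNReal.ofReal τ₁⁻¹ * (ENNReal.ofReal ((8 * h) ^ n) * volume (polarAt Z z₀))))) := by
        gcongr
    _ = ENNReal.ofReal (16 ^ n * (τ₂ / τ₁)) * volume (polarAt Z z₀) := by
        simp only [← mul_assoc]
        rw [← ENNReal.ofReal_mul (by positivity), ← ENNReal.ofReal_mul (by positivity),
          ← ENNReal.ofReal_mul (by positivity), ← ENNReal.ofReal_mul (by positivity)]
        congr 2
        rw [show (16 : ℝ) = 2 * 8 by norm_num, mul_pow, mul_pow]
        field_simp

lemma volume_eq_zero_of_affineDim_lt {S : Set (EuclideanSpace ℝ (Fin n))} (hS : affineDim S < n) :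
    volume S = 0 := by
  have hne : affineSpan ℝ S ≠ ⊤ := by
    intro h
    rw [affineDim, h, AffineSubspace.direction_top, finrank_top, finrank_euclideanSpace_fin] at hS
    exact hS.false
  exact measure_mono_null (subset_affineSpan ℝ S) (Measure.addHaar_affineSubspace _ _ hne)

/-- Cut off `v` by the affine function `ε ⟪a, x - q⟫`. For small `ε` the resulting section lies in
a prescribed neighbourhood of the compact zero set of `v`. -/
lemma exists_section_subset_cthickening (hΩ : IsOpen Ω) (hv : ConvexOn ℝ Ω v)
    (hv0 : ∀ x ∈ Ω, 0 ≤ v x) {S : Set (EuclideanSpace ℝ (Fin n))}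
    (hS : S = {x | x ∈ Ω ∧ v x = 0}) (hSc : IsCompact S) {r : ℝ} (hr : 0 < r)
    (hrΩ : Metric.cthickening r S ⊆ Ω) {a p q : EuclideanSpace ℝ (Fin n)} (hp : p ∈ S)
    (hpq : 0 < inner ℝ a (p - q)) :
    ∃ ε > 0, {x | x ∈ Ω ∧ v x < ε * inner ℝ a (x - q)} ⊆ Metric.cthickening r S := by
  have hcont : ContinuousOn v Ω := hv.continuousOn hΩ
  set B := {x | Metric.infDist x S = r} with hB
  have hBsub : B ⊆ Metric.cthickening r S := fun x hx => by
    rw [hSc.cthickening_eq_biUnion_closedBall hr.le]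
    obtain ⟨y, hy, hxy⟩ := hSc.exists_infDist_eq_dist ⟨p, hp⟩ x
    have hx' : Metric.infDist x S = r := hx
    exact mem_biUnion hy (by rw [Metric.mem_closedBall, ← hxy, hx'])
  have hBc : IsCompact B := hSc.cthickening.of_isClosed_subset
    (isClosed_eq (Metric.continuous_infDist_pt S) continuous_const) hBsub
  have hSzero : ∀ x ∈ S, Metric.infDist x S = 0 := fun x hx => Metric.infDist_zero_of_mem hx
  have hpos : ∀ x ∈ B, 0 < v x := fun x hx => by
    have hxΩ := hrΩ (hBsub hx)
    refine lt_of_le_of_ne (hv0 x hxΩ) fun h => ?_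
    have h0 := hSzero x (hS ▸ ⟨hxΩ, h.symm⟩)
    have hx' : Metric.infDist x S = r := hx
    linarith
  obtain ⟨m, hm, hmB⟩ : ∃ m > 0, ∀ x ∈ B, m ≤ v x := by
    rcases B.eq_empty_or_nonempty with h | h
    · exact ⟨1, one_pos, by simp [h]⟩
    · obtain ⟨x, hx, hmin⟩ := hBc.exists_isMinOn h (hcont.mono (hBsub.trans hrΩ))
      exact ⟨v x, hpos x hx, fun y hy => hmin hy⟩
  obtain ⟨C, hC⟩ := hBc.exists_bound_of_continuousOn
    (f := fun x => inner ℝ a (x - q)) (by fun_prop)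
  refine ⟨m / (|C| + 1), by positivity, ?_⟩
  set ε := m / (|C| + 1) with hε
  have hε0 : 0 < ε := by positivity
  have hBnot : ∀ x ∈ B, ε * inner ℝ a (x - q) ≤ v x := fun x hx => by
    refine le_trans ?_ (hmB x hx)
    have h1 : inner ℝ a (x - q) ≤ |C| + 1 := by
      have h2 := hC x hx
      rw [Real.norm_eq_abs] at h2
      linarith [le_abs_self (inner ℝ a (x - q)), le_abs_self C]
    calc ε * inner ℝ a (x - q) ≤ ε * (|C| + 1) := by gcongr
      _ = m := by rw [hε]; field_simp
  have hpΩ : p ∈ Ω ∧ v p = 0 := by rw [hS] at hp; exact hp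
  intro x hx
  rw [hSc.cthickening_eq_biUnion_closedBall hr.le]
  obtain ⟨y, hy, hxy⟩ := hSc.exists_infDist_eq_dist ⟨p, hp⟩ x
  refine mem_biUnion hy ?_
  rw [Metric.mem_closedBall, ← hxy]
  by_contra! hlt
  -- The segment from `p` to `x` stays in the section, yet it has to cross `B`.
  have hf : ContinuousOn (fun t : ℝ => Metric.infDist (AffineMap.lineMap p x t) S) (Icc 0 1) := by
    refine Continuous.continuousOn ?_
    exact (Metric.continuous_infDist_pt S).comp AffineMap.lineMap_continuous
  obtain ⟨t, ht, hft⟩ := intermediate_value_Icc zero_le_one hf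
    (show r ∈ Icc _ _ by
      simp only [AffineMap.lineMap_apply_zero, AffineMap.lineMap_apply_one]
      exact ⟨by rw [hSzero p hp]; exact hr.le, hlt.le⟩)
  have hconv := hv.2 hpΩ.1 hx.1 (sub_nonneg.mpr ht.2) ht.1 (by ring)
  rw [← AffineMap.lineMap_apply_module, hpΩ.2, smul_zero, zero_add, smul_eq_mul] at hconv
  have hb := hBnot _ hft
  have hlin : inner ℝ a (AffineMap.lineMap p x t - q) =
      (1 - t) * inner ℝ a (p - q) + t * inner ℝ a (x - q) := by
    rw [← inner_smul_right, ← inner_smul_right, ← inner_add_right, AffineMap.lineMap_apply_module]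
    congr 1; module
  rw [hlin] at hb
  have hx2 := hx.2
  rcases ht.1.eq_or_lt with h0 | h0
  · subst h0
    have : 0 < ε * inner ℝ a (p - q) := by positivity
    linarith
  · have h9 : t * v x < t * (ε * inner ℝ a (x - q)) := by gcongr
    have h10 : 0 ≤ (1 - t) * (ε * inner ℝ a (p - q)) :=
      mul_nonneg (by linarith [ht.2]) (by positivity)
    nlinarith

end Section

end MongeAmpere

theorem mainTheorem4 (n : ℕ) (hn : 2 ≤ n)
    (Ω : Set (EuclideanSpace ℝ (Fin n))) (hΩ_open : IsOpen Ω) (hΩ_convex : Convex ℝ Ω)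
    (v : EuclideanSpace ℝ (Fin n) → ℝ)
    (hv_convex : ConvexOn ℝ (closure Ω) v) (hv_nonneg : ∀ x ∈ closure Ω, 0 ≤ v x)
    (S : Set (EuclideanSpace ℝ (Fin n))) (hS : S = {x | x ∈ Ω ∧ v x = 0})
    (hS_nonempty : S.Nonempty) (hS_compact : IsCompact S)
    (hv_strict : MongeAmpere.LocallyStrictConvexOn (Ω \ S) v)
    (ψ : ℝ → ℝ) (hψ_nonneg : ∀ t : ℝ, 0 < t → 0 ≤ ψ t)
    (hψ_anti : AntitoneOn ψ (Set.Ioi 0)) (hψ_ne : ∃ t : ℝ, 0 < t ∧ ψ t ≠ 0)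
    (τ₁ τ₂ : ℝ) (hτ₁ : 0 < τ₁) (hτ : τ₁ < τ₂)
    (hMA : MongeAmpere.DetHessianBounds Ω v ψ τ₁ τ₂ (Ω \ S))
    (hS_dim : MongeAmpere.affineDim S ≤ n - 1)
    (hS_null : MongeAmpere.mongeAmpereMeasure Ω v S = 0) :
    ∃ x : EuclideanSpace ℝ (Fin n), S = {x} := by
  have hcv : ConvexOn ℝ Ω v := hv_convex.subset subset_closure hΩ_convex
  have hv0 : ∀ x ∈ Ω, 0 ≤ v x := fun x hx => hv_nonneg x (subset_closure hx)
  have hS0 := MongeAmpere.volume_eq_zero_of_affineDim_lt (S := S) (by omega)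
  have hSm := hS_compact.measurableSet
  have hSΩ : S ⊆ Ω := by rw [hS]; exact fun x hx => hx.1
  have hScv : Convex ℝ S := by
    have : S = {x | x ∈ Ω ∧ v x ≤ 0} := by
      rw [hS]; ext x
      exact ⟨fun hx => ⟨hx.1, hx.2.le⟩, fun hx => ⟨hx.1, le_antisymm hx.2 (hv0 x hx.1)⟩⟩
    rw [this]; exact hcv.convex_le 0
  rcases hS_nonempty.exists_eq_singleton_or_nontrivial with h | ⟨p₀, hp₀, q, hq, hne⟩
  · exact h
  exfalso
  obtain ⟨p, hp, hmax⟩ := hS_compact.exists_isMaxOn hS_nonempty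
    (f := fun x => inner ℝ (p₀ - q) x) (by fun_prop)
  set a := p₀ - q with ha
  have hmax' : ∀ x ∈ S, inner ℝ a (x - p) ≤ 0 := fun x hx => by
    have : inner ℝ a x ≤ inner ℝ a p := hmax hx
    rw [inner_sub_right]; linarith
  set A := inner ℝ a (p - q) with hA
  have hA0 : 0 < A := by
    have h1 : 0 < inner ℝ a a := real_inner_self_pos.mpr (sub_ne_zero.mpr hne)
    have h2 := hmax' p₀ hp₀
    have h3 : inner ℝ a a = inner ℝ a (p₀ - p) + A := by
      rw [hA, ← inner_add_right, sub_add_sub_cancel]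
    linarith
  set e := (3⁻¹ : ℝ) • (p - q) with he
  have hae : inner ℝ a e = 3⁻¹ * A := by rw [he, inner_smul_right]
  -- Enough disjoint pieces to beat the ratio bound `16 ^ n * (τ₂ / τ₁)`, each piece having
  -- at least `6⁻ⁿ` of the volume of the polar body.
  obtain ⟨m, hm⟩ := exists_nat_gt (6 ^ n * (16 ^ n * (τ₂ / τ₁)))
  -- With this `T`, the vector `T • a` has inner product `4 * m + 1` with `e`.
  set T := 3 * (4 * m + 1) / A with hT
  have hT0 : 0 < T := by positivity
  -- `⟪a, x - p⟫ ≤ κ` on the section keeps `⟪T • a, x - p⟫` below `1` there.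
  set κ := min (1 / T) A with hκ
  have hκ0 : 0 < κ := lt_min (by positivity) hA0
  obtain ⟨r₀, hr₀, hr₀Ω⟩ := hS_compact.exists_cthickening_subset_open hΩ_open hSΩ
  set r := min r₀ (κ / (‖a‖ + 1)) with hr
  have hr0 : 0 < r := lt_min hr₀ (by positivity)
  have hrΩ : Metric.cthickening r S ⊆ Ω :=
    (Metric.cthickening_mono (min_le_left _ _) S).trans hr₀Ω
  have hthick : ∀ x ∈ Metric.cthickening r S, inner ℝ a (x - p) ≤ κ := by
    intro x hx
    rw [hS_compact.cthickening_eq_biUnion_closedBall hr0.le] at hx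
    simp only [Set.mem_iUnion] at hx
    obtain ⟨y, hy, hxy⟩ := hx
    rw [mem_closedBall_iff_norm] at hxy
    have h1 := hmax' y hy
    have h2 : inner ℝ a (x - p) = inner ℝ a (x - y) + inner ℝ a (y - p) := by
      rw [← inner_add_right, sub_add_sub_cancel]
    have h3 : inner ℝ a (x - y) ≤ κ := by
      calc inner ℝ a (x - y) ≤ ‖a‖ * ‖x - y‖ := real_inner_le_norm _ _
        _ ≤ (‖a‖ + 1) * (κ / (‖a‖ + 1)) := by
            gcongr
            · linarith
            · exact hxy.trans (min_le_right _ _)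
        _ = κ := by field_simp
    linarith
  obtain ⟨ε, hε, hsec⟩ := MongeAmpere.exists_section_subset_cthickening hΩ_open hcv hv0 hS
    hS_compact hr0 hrΩ hp hA0
  set Z := {x | x ∈ Ω ∧ v x < ε * inner ℝ a (x - q)} with hZ
  have hZ' : Z = {x | x ∈ Ω ∧ v x < inner ℝ (ε • a) x - ε * inner ℝ a q} := by
    simp only [hZ, inner_smul_left, inner_sub_right, conj_trivial, mul_sub]
  have hZclosure : closure Z ⊆ Metric.cthickening r S :=
    closure_minimal hsec Metric.isClosed_cthickening
  have hZb : Bornology.IsBounded Z := hS_compact.isBounded.cthickening.subset hsec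
  have hZo : IsOpen Z := by
    have : Z = Ω ∩ (fun x => v x - ε * inner ℝ a (x - q)) ⁻¹' Set.Iio 0 := by
      ext x
      simp only [hZ, Set.mem_ofPred_eq, Set.mem_inter_iff, Set.mem_preimage, Set.mem_Iio, sub_neg]
    rw [this]
    exact ((hcv.continuousOn hΩ_open).sub (by fun_prop)).isOpen_inter_preimage hΩ_open isOpen_Iio
  have hZc : Convex ℝ Z := by
    have h1 : ConvexOn ℝ Ω fun x => v x - inner ℝ (ε • a) x :=
      hcv.sub ((innerₛₗ ℝ (ε • a)).concaveOn hcv.1)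
    have : Z = {x | x ∈ Ω ∧ v x - inner ℝ (ε • a) x < -(ε * inner ℝ a q)} := by
      rw [hZ']; ext x; simp only [Set.mem_ofPred_eq]
      constructor <;> rintro ⟨h1, h2⟩ <;> exact ⟨h1, by linarith⟩
    rw [this]; exact h1.convex_lt _
  -- Points of the segment `[q, p] ⊆ S` other than `q` lie in `Z`.
  have hseg : ∀ t : ℝ, 0 ≤ t → t < 1 → p - t • (p - q) ∈ S ∧ p - t • (p - q) ∈ Z := by
    intro t ht0 ht1
    have h1 : p - t • (p - q) ∈ S := by
      have : p - t • (p - q) = (1 - t) • p + t • q := by module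
      rw [this]; exact hScv hp hq (by linarith) ht0 (by ring)
    refine ⟨h1, hSΩ h1, ?_⟩
    have h2 : v (p - t • (p - q)) = 0 := by
      have := h1; rw [hS] at this; exact this.2
    have h3 : p - t • (p - q) - q = (1 - t) • (p - q) := by module
    rw [h2, h3, inner_smul_right, ← hA]
    have : 0 < 1 - t := by linarith
    positivity
  have hpZ : p ∈ Z := by simpa using (hseg 0 le_rfl one_pos).2
  have hz₀ := hseg 3⁻¹ (by norm_num) (by norm_num)
  rw [← he] at hz₀
  have hq₁ : p - e - e ∈ Z := by
    have := (hseg (2 / 3) (by norm_num) (by norm_num)).2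
    rwa [show p - (2 / 3 : ℝ) • (p - q) = p - e - e by rw [he]; module] at this
  have hup := MongeAmpere.volume_polarAt_le_of_detHessianBounds hΩ_open hcv hv0 hS hSm hS0 hS_null
    hψ_anti hτ₁ (hτ₁.trans hτ) hMA hZ' hZo hZc hZb (hZclosure.trans hrΩ) (h := ε * A / 2) hpZ hp
    hz₀.2 hz₀.1 (by rw [inner_smul_left, hA, inner_sub_right]; simp only [conj_trivial]; ring)
    (by
      intro x hx
      have h1 := hthick x (hsec hx)
      have h2 : κ ≤ A := min_le_right _ _
      have h3 : inner ℝ a x - inner ℝ a q = inner ℝ a (x - p) + A := by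
        rw [hA, ← inner_add_right, sub_add_sub_cancel, inner_sub_right]
      rw [inner_smul_left, conj_trivial, ← mul_sub, h3]
      calc ε * (inner ℝ a (x - p) + A) ≤ ε * (A + A) := by gcongr; linarith
        _ = _ := by ring)
  have hlow := MongeAmpere.nat_mul_volume_polarAt_le (Y := T • a) m hpZ hq₁
    (by
      intro x hx
      have h1 := hthick x (hsec hx)
      have h2 : κ ≤ 1 / T := min_le_left _ _
      rw [inner_smul_left, conj_trivial]
      calc T * inner ℝ a (x - p) ≤ T * (1 / T) := by gcongr; linarith
        _ = 1 := by field_simp)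
    (by
      rw [inner_smul_left, conj_trivial, hae, hT]
      have : 3 * (4 * (m : ℝ) + 1) / A * (3⁻¹ * A) = 4 * m + 1 := by field_simp
      linarith)
  rw [finrank_euclideanSpace_fin] at hlow
  have hfin : MeasureTheory.volume (MongeAmpere.polarAt Z (p - e)) ≠ ⊤ := by
    obtain ⟨δ, hδ, hδZ⟩ := Metric.nhds_basis_closedBall.mem_iff.mp (hZo.mem_nhds hz₀.2)
    exact ((MeasureTheory.measure_mono (MongeAmpere.polarAt_subset_closedBall hδ hδZ)).trans_lt
      MeasureTheory.measure_closedBall_lt_top).ne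
  have hpos : MeasureTheory.volume (MongeAmpere.polarAt Z (p - e)) ≠ 0 := by
    obtain ⟨R, hR⟩ := hZb.subset_closedBall (p - e)
    have hR' : Z ⊆ Metric.closedBall (p - e) (max R 1) :=
      hR.trans (Metric.closedBall_subset_closedBall (le_max_left _ _))
    have hR1 : 0 < max R 1 := lt_max_of_lt_right one_pos
    exact ((Metric.measure_ball_pos _ _ (by positivity)).trans_le
      (MeasureTheory.measure_mono (MongeAmpere.ball_subset_polarAt hR1 hR'))).ne'
  have hcmp := hlow.trans hup
  rw [← mul_assoc, ENNReal.mul_le_mul_iff_left hpos hfin, ← ENNReal.ofReal_natCast,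
    ← ENNReal.ofReal_mul (by positivity), ENNReal.ofReal_le_ofReal_iff
      (by have := hτ₁.trans hτ; positivity)] at hcmp
  have h6 : (0 : ℝ) < 6 ^ n := by positivity
  have : (m : ℝ) ≤ 6 ^ n * (16 ^ n * (τ₂ / τ₁)) := by
    calc (m : ℝ) = 6 ^ n * (m * (1 / 6) ^ n) := by
          rw [one_div, inv_pow]; field_simp
      _ ≤ _ := by gcongr
  linarith
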